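/- Let $m\ge 1$, let $0<t<1$, and let $\mathbb{P}_m$ be the set of $m\times m$ (complex Hermitian) positive definite matrices. Let $\Delta_n$ be the set of vectors $\omega=(w_1,\dots,w_n)$ with all $w_j>0$ and $\sum_{j=1}^n w_j=1$. For $\omega\in\Delta_n$ and $\mathbb{A}=(A_1,\dots,A_n)\in\mathbb{P}_m^n$, the parameterized Wasserstein mean is $$\Omega_t(\omega;\mathbb{A})=\underset{X\in\mathbb{P}_m}{\arg\min}\ \sum_{j=1}^n w_j\Big[\operatorname{tr}\big((1-t)A_j+tX\big)-\operatorname{tr}\big(A_j^{\frac{1-t}{2t}}XA_j^{\frac{1-t}{2t}}\big)^t\Big].$$ Then this minimizer exists and is unique, so that $\Omega_t(\omega;\mathbb{A})\in\mathbb{P}_m$ is well defined, and the following hold for all $n\ge1$, $\omega\in\Delta_n$ and $\mathbb{A}\in\mathbb{P}_m^n$. 1. (Consistency with scalars) If the $A_j$ commute pairwise, then $\Omega_t(\omega;\mathbb{A})=\Big(\sum_{j=1}^n w_jA_j^{1-t}\Big)^{\frac1{1-t}}$. 2. (Homogeneity) $\Omega_t(\omega;\alpha A_1,\dots,\alpha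 A_n)=\alpha\,\Omega_t(\omega;\mathbb{A})$ for every real $\alpha>0$. 3. (Permutation invariance) $\Omega_t(w_{\sigma(1)},\dots,w_{\sigma(n)};A_{\sigma(1)},\dots,A_{\sigma(n)})=\Omega_t(\omega;\mathbb{A})$ for every permutation $\sigma$ of $\{1,\dots,n\}$. 4. (Repetition invariance) For every integer $p\ge1$, $\Omega_t(\omega^{p};\mathbb{A}^{p})=\Omega_t(\omega;\mathbb{A})$, where $\mathbb{A}^{p}\in\mathbb{P}_m^{np}$ consists of $p$ consecutive copies of $(A_1,\dots,A_n)$ and $\omega^{p}\in\Delta_{np}$ is $\frac1p$ times the vector of $p$ consecutive copies of $(w_1,\dots,w_n)$. 5. (Unitary congruence invariance) $\Omega_t(\omega;UA_1U^*,\dots,UA_nU^*)=U\,\Omega_t(\omega;\mathbb{A})\,U^*$ for every unitary $m\times m$ matrix $U$. 6. (Determinantal inequality) $\det\Omega_t(\omega;\mathbb{A})\ge\prod_{j=1}^n(\det A_j)^{w_j}$. Moreover, for $n\ge2$, $\omega\in\Delta_n$ and $A_1,\dots,A_{n-1},X\in\mathbb{P}_m$, the vector $\hat\omega=\frac{1}{1-w_n}(w_1,\dots,w_{n-1})$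 lies in $\Delta_{n-1}$, and $$X=\Omega_t(\omega;A_1,\dots,A_{n-1},X)\iff X=\Omega_t(\hat\omega;A_1,\dots,A_{n-1}).$$ -/

import Mathlib

open scoped ComplexOrder MatrixOrder Matrix

/-- Positive probability vectors with `n` entries. -/
def posProbVec (n : ℕ) : Set (Fin n → ℝ) :=
  {w | (∀ j, 0 < w j) ∧ ∑ j, w j = 1}

/-- The sandwiched quasi-relative entropy `tr (A^((1-t)/(2t)) X A^((1-t)/(2t)))^t`.
Real powers of positive (semi)definite matrices are those of the functional calculus; the trace
is real there. -/
noncomputable def sandwichedEntropy {m : ℕ} (t : ℝ) (A X : Matrix (Fin m) (Fin m) ℂ) : ℝ :=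
  (Matrix.trace ((A ^ ((1 - t) / (2 * t)) * X * A ^ ((1 - t) / (2 * t))) ^ t)).re

/-- The objective function
`∑ j, w j * (tr ((1-t) A j + t X) - tr (A j^((1-t)/(2t)) X A j^((1-t)/(2t)))^t)`. -/
noncomputable def wassersteinObjective {m n : ℕ} (t : ℝ) (w : Fin n → ℝ)
    (A : Fin n → Matrix (Fin m) (Fin m) ℂ) (X : Matrix (Fin m) (Fin m) ℂ) : ℝ :=
  ∑ j, w j * ((Matrix.trace ((1 - t) • A j + t • X)).re - sandwichedEntropy t (A j) X)

/-- `X` minimizes the objective function over the cone of positive definite matrices. -/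
def IsParamWassersteinMean {m n : ℕ} (t : ℝ) (w : Fin n → ℝ)
    (A : Fin n → Matrix (Fin m) (Fin m) ℂ) (X : Matrix (Fin m) (Fin m) ℂ) : Prop :=
  X.PosDef ∧ IsMinOn (wassersteinObjective t w A) {Y | Y.PosDef} X

open Classical in
/-- The parameterized Wasserstein mean: the minimizer over the positive definite
matrices of the objective function (and `0` if there were none). -/
noncomputable def paramWassersteinMean {m n : ℕ} (t : ℝ) (w : Fin n → ℝ)
    (A : Fin n → Matrix (Fin m) (Fin m) ℂ) : Matrix (Fin m) (Fin m) ℂ :=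
  if h : ∃ X, IsParamWassersteinMean t w A X then h.choose else 0

/-! Write `S_j = A_j^((1-t)/(2t))`. Up to a constant, the objective is `t tr X - ∑ w_j tr (S_j X
S_j)^t`, and its gradient is `t (1 - G(X))` with `G = gradSum t w A`. Klein's inequality for `x ↦
x^t` (`trace_rpow_le_tangent`) puts the objective above its tangents, strictly away from the contact
point. So a solution of `G(X) = 1` is the unique minimizer, and no derivative is ever taken.

To solve `G(X) = 1` (`exists_gradSum_eq_one`), minimize over a compact interval `[a, b]` of matrices
chosen so that `X ↦ X^(1/2) G(X) X^(1/2)` maps it to itself. This image, used as test point in the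
first-order condition at the minimizer `X`, gives `tr ((1-G) X^(1/2) (1-G) X^(1/2)) ≤ 0`, which
forces `G(X) = 1`.

By `eq_paramWassersteinMean_iff` the listed properties become identities for `G`. The determinantal
inequality comes from averaging `log det ≤ tr - m` over the terms of `G(X) = 1`. -/

namespace Matrix.PosDef

/-! ### Real powers through the spectral decomposition -/

variable {m : ℕ} {A B X Z : Matrix (Fin m) (Fin m) ℂ}

lemma nonneg' (hA : A.PosDef) : 0 ≤ A := hA.posSemidef.nonneg

/-- Spectral form of real powers. -/
lemma rpow_eq (hA : A.PosDef) (r : ℝ) :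
    A ^ r = (hA.1.eigenvectorUnitary : Matrix (Fin m) (Fin m) ℂ) *
      diagonal (fun i => ((hA.1.eigenvalues i ^ r : ℝ) : ℂ)) *
      (hA.1.eigenvectorUnitary : Matrix (Fin m) (Fin m) ℂ)ᴴ := by
  rw [CFC.rpow_eq_cfc_real (ha := hA.nonneg'), hA.1.cfc_eq, IsHermitian.cfc,
    Unitary.conjStarAlgAut_apply]
  rfl

lemma rpow (hA : A.PosDef) (r : ℝ) : (A ^ r).PosDef :=
  isStrictlyPositive_iff_posDef.1
    (IsStrictlyPositive.rpow A r (isStrictlyPositive_iff_posDef.2 hA))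

lemma rpow_add (hA : A.PosDef) (p q : ℝ) : A ^ (p + q) = A ^ p * A ^ q :=
  CFC.rpow_add hA.isUnit

lemma rpow_rpow (hA : A.PosDef) {p : ℝ} (hp : p ≠ 0) (q : ℝ) : (A ^ p) ^ q = A ^ (p * q) :=
  CFC.rpow_rpow A p q hp (isStrictlyPositive_iff_posDef.2 hA)

lemma rpow_zero (hA : A.PosDef) : A ^ (0 : ℝ) = 1 := CFC.rpow_zero A hA.nonneg'

lemma rpow_one (hA : A.PosDef) : A ^ (1 : ℝ) = A := CFC.rpow_one A hA.nonneg'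

/-- A matrix intertwining two positive definite matrices intertwines their powers. -/
lemma intertwine_rpow (hA : A.PosDef) (hB : B.PosDef) {T : Matrix (Fin m) (Fin m) ℂ}
    (h : T * A = B * T) (r : ℝ) : T * A ^ r = B ^ r * T := by
  have key (p : ℝ) : T * A ^ p = B ^ p * T ↔
      ((hB.1.eigenvectorUnitary : Matrix (Fin m) (Fin m) ℂ)ᴴ * T * hA.1.eigenvectorUnitary) *
        diagonal (fun i => ((hA.1.eigenvalues i ^ p : ℝ) : ℂ)) =
      diagonal (fun i => ((hB.1.eigenvalues i ^ p : ℝ) : ℂ)) *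
      ((hB.1.eigenvectorUnitary : Matrix (Fin m) (Fin m) ℂ)ᴴ * T * hA.1.eigenvectorUnitary) := by
    rw [hA.rpow_eq, hB.rpow_eq]
    set U := (hA.1.eigenvectorUnitary : Matrix (Fin m) (Fin m) ℂ)
    set V := (hB.1.eigenvectorUnitary : Matrix (Fin m) (Fin m) ℂ)
    have hU : Uᴴ * U = 1 := Unitary.coe_star_mul_self hA.1.eigenvectorUnitary
    have hU' : U * Uᴴ = 1 := Unitary.coe_mul_star_self hA.1.eigenvectorUnitary
    have hV : Vᴴ * V = 1 := Unitary.coe_star_mul_self hB.1.eigenvectorUnitary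
    have hV' : V * Vᴴ = 1 := Unitary.coe_mul_star_self hB.1.eigenvectorUnitary
    constructor
    · intro h
      calc _ = Vᴴ * (T * (U * diagonal (fun i => ((hA.1.eigenvalues i ^ p : ℝ) : ℂ)) * Uᴴ)) * U := by
            simp only [mul_assoc, hU, mul_one]
        _ = _ := by
            rw [h]; simp only [← mul_assoc, hV, one_mul]
    · intro h
      calc _ = V * (Vᴴ * T * U * diagonal (fun i => ((hA.1.eigenvalues i ^ p : ℝ) : ℂ))) * Uᴴ := by
            simp only [← mul_assoc, hV', one_mul]
        _ = _ := by
            rw [h]; simp only [mul_assoc, hU', mul_one]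
  rw [key]
  have h1 := (key 1).1 (by rwa [hA.rpow_one, hB.rpow_one])
  -- In the two eigenbases the relation reads `T_ij a_j = b_i T_ij`: each entry vanishes or its two
  -- eigenvalues agree, and then so do their powers.
  ext i j
  have hij := congrFun (congrFun h1 i) j
  rw [mul_diagonal, diagonal_mul] at hij ⊢
  rw [Real.rpow_one, Real.rpow_one, mul_comm] at hij
  rw [mul_comm]
  by_cases h0 : ((hB.1.eigenvectorUnitary : Matrix (Fin m) (Fin m) ℂ)ᴴ * T *
    hA.1.eigenvectorUnitary) i j = 0
  · rw [h0, mul_zero, mul_zero]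
  · rw [Complex.ofReal_injective (mul_right_cancel₀ h0 hij)]

lemma rpow_commute (hA : A.PosDef) {T : Matrix (Fin m) (Fin m) ℂ} (h : Commute T A) (r : ℝ) :
    Commute T (A ^ r) := hA.intertwine_rpow hA h r

/-- Conjugation by a unitary matrix commutes with powers. -/
lemma unitary_conj_rpow (hA : A.PosDef) {U : Matrix (Fin m) (Fin m) ℂ}
    (hU : U ∈ unitaryGroup (Fin m) ℂ) (r : ℝ) : (U * A * Uᴴ) ^ r = U * A ^ r * Uᴴ := by
  have h1 : Uᴴ * U = 1 := mem_unitaryGroup_iff'.1 hU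
  have h2 : U * Uᴴ = 1 := mem_unitaryGroup_iff.1 hU
  have hB : (U * A * Uᴴ).PosDef := hA.mul_mul_conjTranspose_same
    (vecMul_injective_of_isUnit (IsUnit.of_mul_eq_one _ h2))
  have := hA.intertwine_rpow hB (T := U) (by rw [mul_assoc _ Uᴴ U, h1, mul_one]) r
  rw [this, mul_assoc _ U Uᴴ, h2, mul_one]

/-- Both matrices are diagonalized separately; the squared overlaps of the eigenvectors are
nonnegative weights independent of `p` and `q`. Trace inequalities for noncommuting matrices thus
reduce to scalar ones. -/
lemma trace_rpow_mul_rpow (hX : X.PosDef) (hZ : Z.PosDef) (p q : ℝ) :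
    (trace (X ^ p * Z ^ q)).re = ∑ i, ∑ j, hX.1.eigenvalues i ^ p * hZ.1.eigenvalues j ^ q *
      Complex.normSq (((hX.1.eigenvectorUnitary : Matrix (Fin m) (Fin m) ℂ)ᴴ *
        hZ.1.eigenvectorUnitary) i j) := by
  rw [hX.rpow_eq, hZ.rpow_eq]
  set U := (hX.1.eigenvectorUnitary : Matrix (Fin m) (Fin m) ℂ)
  set V := (hZ.1.eigenvectorUnitary : Matrix (Fin m) (Fin m) ℂ)
  have : trace (U * diagonal (fun i => ((hX.1.eigenvalues i ^ p : ℝ) : ℂ)) * Uᴴ *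
      (V * diagonal (fun i => ((hZ.1.eigenvalues i ^ q : ℝ) : ℂ)) * Vᴴ)) =
      trace (diagonal (fun i => ((hX.1.eigenvalues i ^ p : ℝ) : ℂ)) * ((Uᴴ * V) *
        diagonal (fun i => ((hZ.1.eigenvalues i ^ q : ℝ) : ℂ)) * (Uᴴ * V)ᴴ)) := by
    rw [mul_assoc, mul_assoc, trace_mul_comm]
    simp only [conjTranspose_mul, conjTranspose_conjTranspose, mul_assoc]
  rw [this, trace, Complex.re_sum]
  refine Finset.sum_congr rfl fun i _ => ?_
  rw [diag_apply, diagonal_mul, mul_apply, Complex.re_ofReal_mul, Complex.re_sum, Finset.mul_sum]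
  refine Finset.sum_congr rfl fun j _ => ?_
  have hw (w : ℂ) : w * star w = (Complex.normSq w : ℂ) := Complex.mul_conj w
  rw [mul_diagonal, conjTranspose_apply, mul_right_comm, hw, ← Complex.ofReal_mul,
    Complex.ofReal_re]
  ring

end Matrix.PosDef

/-! ### Klein's inequality with its equality case -/

/-- Strict Bernoulli inequality at `s = x / z - 1`, multiplied by `z ^ t`. -/
lemma Real.rpow_lt_tangent {x z t : ℝ} (hx : 0 < x) (hz : 0 < z) (ht0 : 0 < t) (ht1 : t < 1)
    (hne : x ≠ z) : x ^ t < t * (x * z ^ (t - 1)) + (1 - t) * z ^ t := by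
  have h := rpow_one_add_lt_one_add_mul_self (s := x / z - 1) (by linarith [div_pos hx hz])
    (by rw [sub_ne_zero, Ne, div_eq_one_iff_eq hz.ne']; exact hne) ht0 ht1
  rw [add_sub_cancel, Real.div_rpow hx.le hz.le, div_lt_iff₀ (Real.rpow_pos_of_pos hz t)] at h
  refine h.trans_eq ?_
  rw [Real.rpow_sub_one hz.ne']
  field_simp
  ring

namespace Matrix.PosDef

variable {m : ℕ} {A B X Z : Matrix (Fin m) (Fin m) ℂ}

lemma eq_zero_of_trace_mul_self_re_eq_zero {H : Matrix (Fin m) (Fin m) ℂ} (hH : H.IsHermitian)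
    (h : (trace (H * H)).re = 0) : H = 0 := by
  have h2 : trace (Hᴴ * H) = 0 := by
    have h3 := (posSemidef_conjTranspose_mul_self H).trace_nonneg
    rw [hH.eq] at h3 ⊢
    exact Complex.ext h (Complex.nonneg_iff.1 h3).2.symm
  exact trace_conjTranspose_mul_self_eq_zero_iff.1 h2

/-- Klein's inequality for the concave function `x ↦ x ^ t`, with its equality case. -/
theorem trace_rpow_le_tangent (hX : X.PosDef) (hZ : Z.PosDef) {t : ℝ} (ht0 : 0 < t) (ht1 : t < 1) :
    (trace (X ^ t)).re ≤ t * (trace (X * Z ^ (t - 1))).re + (1 - t) * (trace (Z ^ t)).re ∧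
    ((trace (X ^ t)).re = t * (trace (X * Z ^ (t - 1))).re + (1 - t) * (trace (Z ^ t)).re →
      X = Z) := by
  -- A zero exponent brings the trace of a single power into the same double sum as the mixed
  -- traces.
  have e1 := hX.trace_rpow_mul_rpow hZ t 0
  have e2 := hX.trace_rpow_mul_rpow hZ 1 (t - 1)
  have e3 := hX.trace_rpow_mul_rpow hZ 0 t
  have f1 := hX.trace_rpow_mul_rpow hZ 2 0
  have f2 := hX.trace_rpow_mul_rpow hZ 1 1
  have f3 := hX.trace_rpow_mul_rpow hZ 0 2
  rw [hZ.rpow_zero, mul_one] at e1 f1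
  rw [hX.rpow_one] at e2 f2
  rw [hZ.rpow_one] at f2
  rw [hX.rpow_zero, one_mul] at e3 f3
  set W := (hX.1.eigenvectorUnitary : Matrix (Fin m) (Fin m) ℂ)ᴴ *
        hZ.1.eigenvectorUnitary
  set x := hX.1.eigenvalues
  set z := hZ.1.eigenvalues
  have hx (i) : 0 < x i := hX.eigenvalues_pos i
  have hz (i) : 0 < z i := hZ.eigenvalues_pos i
  have key : t * (trace (X * Z ^ (t - 1))).re + (1 - t) * (trace (Z ^ t)).re - (trace (X ^ t)).re =
      ∑ i, ∑ j, (t * (x i * z j ^ (t - 1)) + (1 - t) * z j ^ t - x i ^ t) *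
        Complex.normSq (W i j) := by
    rw [e1, e2, e3]
    simp only [Finset.mul_sum, ← Finset.sum_add_distrib, ← Finset.sum_sub_distrib]
    refine Finset.sum_congr rfl fun i _ => Finset.sum_congr rfl fun j _ => ?_
    rw [Real.rpow_zero, Real.rpow_zero, Real.rpow_one]
    ring
  have hnn (i j) : 0 ≤ (t * (x i * z j ^ (t - 1)) + (1 - t) * z j ^ t - x i ^ t) *
        Complex.normSq (W i j) := by
    refine mul_nonneg ?_ (Complex.normSq_nonneg _)
    by_cases h : x i = z j
    · rw [h, Real.rpow_sub_one (hz j).ne', mul_div_cancel₀ _ (hz j).ne']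
      linarith
    · linarith [Real.rpow_lt_tangent (hx i) (hz j) ht0 ht1 h]
  refine ⟨sub_nonneg.1 (key ▸ Finset.sum_nonneg fun i _ => Finset.sum_nonneg fun j _ => hnn i j),
    fun heq => ?_⟩
  rw [← heq, sub_self, eq_comm, Finset.sum_eq_zero_iff_of_nonneg
    fun i _ => Finset.sum_nonneg fun j _ => hnn i j] at key
  -- Equality forces `x i = z j` wherever the overlap is nonzero. The sum of these terms is `tr (X -
  -- Z)^2`, which therefore vanishes.
  have hW (i j) : (x i - z j) ^ 2 * Complex.normSq (W i j) = 0 := by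
    have := (Finset.sum_eq_zero_iff_of_nonneg fun j _ => hnn i j).1
      (key i (Finset.mem_univ i)) j (Finset.mem_univ j)
    by_cases h : x i = z j
    · simp [h]
    · rcases mul_eq_zero.1 this with h' | h'
      · linarith [Real.rpow_lt_tangent (hx i) (hz j) ht0 ht1 h]
      · rw [h', mul_zero]
  have sq {Y : Matrix (Fin m) (Fin m) ℂ} (hY : Y.PosDef) : Y ^ (2 : ℝ) = Y * Y := by
    rw [← one_add_one_eq_two, hY.rpow_add, hY.rpow_one]
  refine sub_eq_zero.1 (eq_zero_of_trace_mul_self_re_eq_zero (hX.1.sub hZ.1) ?_)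
  have : trace ((X - Z) * (X - Z)) = trace (X ^ (2 : ℝ)) - (2 : ℝ) * trace (X * Z) +
      trace (Z ^ (2 : ℝ)) := by
    rw [sq hX, sq hZ, sub_mul, mul_sub, mul_sub, trace_sub, trace_sub, trace_sub,
      trace_mul_comm Z X]
    push_cast
    ring
  rw [this, Complex.add_re, Complex.sub_re, Complex.re_ofReal_mul, f1, f2, f3]
  simp only [Finset.mul_sum, ← Finset.sum_add_distrib, ← Finset.sum_sub_distrib]
  refine Finset.sum_eq_zero fun i _ => Finset.sum_eq_zero fun j _ => ?_
  refine Eq.trans ?_ (hW i j)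
  simp only [Real.rpow_zero, Real.rpow_one, Real.rpow_two]
  ring

end Matrix.PosDef

/-! ### Commuting products, continuity, order bounds and determinants -/

namespace Matrix.PosDef

variable {m : ℕ} {A B X Y Z : Matrix (Fin m) (Fin m) ℂ}

lemma mul_of_commute (hA : A.PosDef) (hB : B.PosDef) (h : Commute A B) : (A * B).PosDef := by
  have hC := hA.rpow (1 / 2)
  have h1 : A = A ^ (1 / 2 : ℝ) * A ^ (1 / 2 : ℝ) := by
    rw [← hA.rpow_add, add_halves, hA.rpow_one]
  have h2 : Commute B (A ^ (1 / 2 : ℝ)) := hA.rpow_commute h.symm _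
  -- For commuting factors the product is a congruence of `B` by `A^(1/2)`.
  have h3 : A * B = A ^ (1 / 2 : ℝ) * B * (A ^ (1 / 2 : ℝ))ᴴ := by
    rw [hC.1.eq, mul_assoc, h2.eq, ← mul_assoc, ← h1]
  rw [h3]
  exact hB.mul_mul_conjTranspose_same (vecMul_injective_of_isUnit hC.isUnit)

lemma sandwich (hB : B.PosDef) (hX : X.PosDef) : (B * X * B).PosDef := by
  have := hX.mul_mul_conjTranspose_same (vecMul_injective_of_isUnit hB.isUnit)
  rwa [hB.1.eq] at this

section Log
open scoped Matrix.Norms.L2Operator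

lemma exp_log (hA : A.PosDef) : NormedSpace.exp (CFC.log A) = A :=
  CFC.exp_log A (isStrictlyPositive_iff_posDef.2 hA)

lemma rpow_eq_exp (hA : A.PosDef) (r : ℝ) : A ^ r = NormedSpace.exp (r • CFC.log A) := by
  have hs : ∀ x ∈ spectrum ℝ A, 0 < x := fun x hx =>
    (isStrictlyPositive_iff_posDef.2 hA).spectrum_pos hx
  have hc : ContinuousOn Real.log (spectrum ℝ A) :=
    Real.continuousOn_log.mono fun x hx => (hs x hx).ne'
  rw [CFC.rpow_eq_cfc_real (ha := hA.nonneg'), CFC.log, ← cfc_smul r Real.log A hc,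
    ← CFC.real_exp_eq_normedSpace_exp (cfc_predicate _ A)]
  refine Eq.trans ?_
    (cfc_comp' Real.exp (fun x => r • Real.log x) A (by fun_prop) (hc.const_smul r) hA.1)
  refine cfc_congr fun x hx => ?_
  simp only [Real.rpow_def_of_pos (hs x hx), smul_eq_mul, mul_comm]

lemma mul_rpow (hA : A.PosDef) (hB : B.PosDef) (h : Commute A B) (r : ℝ) :
    (A * B) ^ r = A ^ r * B ^ r := by
  have hl : Commute (CFC.log A) (CFC.log B) :=
    (Commute.cfc_real (Commute.cfc_real h Real.log).symm Real.log).symm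
  -- Commuting logarithms add under `exp`; taking `log` of the resulting product identity gives
  -- additivity.
  have hlog : CFC.log (A * B) = CFC.log A + CFC.log B := by
    rw [← CFC.log_exp (CFC.log A + CFC.log B) (IsSelfAdjoint.log.add IsSelfAdjoint.log),
      Matrix.exp_add_of_commute _ _ hl, hA.exp_log, hB.exp_log]
  rw [(hA.mul_of_commute hB h).rpow_eq_exp, hA.rpow_eq_exp, hB.rpow_eq_exp, hlog, smul_add,
    Matrix.exp_add_of_commute _ _ ((hl.smul_left r).smul_right r)]

lemma continuousOn_rpow (r : ℝ) :
    ContinuousOn (fun X : Matrix (Fin m) (Fin m) ℂ => X ^ r) {X | X.PosDef} := by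
  refine ContinuousOn.cfc_nnreal_of_mem_nhdsSet (s := Set.Ioi 0) _ ?_ continuousOn_id
    (fun X hX => hX.nonneg') ?_
  · refine isOpen_Ioi.mem_nhdsSet.2 (Set.iUnion₂_subset fun X hX x hx => ?_)
    have h0 : x ≠ 0 := fun h0 => spectrum.zero_notMem _ hX.isUnit (h0 ▸ hx)
    exact pos_iff_ne_zero.2 h0
  · exact fun x hx => (NNReal.continuousAt_rpow_const (Or.inl (ne_of_gt hx))).continuousWithinAt

/-- Boundedness comes from monotonicity of the operator norm on `0 ≤ X - a ≤ b - a`. -/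
lemma isCompact_Icc (a b : ℝ) :
    IsCompact (Set.Icc (a • 1 : Matrix (Fin m) (Fin m) ℂ) (b • 1)) := by
  have : ProperSpace (Matrix (Fin m) (Fin m) ℂ) := FiniteDimensional.proper_real _
  refine Metric.isCompact_of_isClosed_isBounded isClosed_Icc ?_
  refine (Metric.isBounded_closedBall (x := a • 1) (r := ‖(b • 1 - a • 1 :
    Matrix (Fin m) (Fin m) ℂ)‖)).subset fun X hX => ?_
  rw [mem_closedBall_iff_norm]
  exact CStarAlgebra.norm_le_norm_of_nonneg_of_le (sub_nonneg.2 hX.1) (sub_le_sub_right hX.2 _)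

lemma rpow_le_rpow_of_le (hXY : X ≤ Y) {p : ℝ} (hp : p ∈ Set.Icc (0 : ℝ) 1) : X ^ p ≤ Y ^ p :=
  CFC.rpow_le_rpow hp hXY

end Log

lemma smul_one_rpow {a : ℝ} (ha : 0 < a) (r : ℝ) :
    (a • 1 : Matrix (Fin m) (Fin m) ℂ) ^ r = a ^ r • 1 := by
  lift a to NNReal using ha.le
  have := CFC.rpow_algebraMap (A := Matrix (Fin m) (Fin m) ℂ) (x := a) (y := r)
  rw [Algebra.algebraMap_eq_smul_one, Algebra.algebraMap_eq_smul_one] at this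
  exact this

lemma smul_rpow (hA : A.PosDef) {a : ℝ} (ha : 0 < a) (r : ℝ) : (a • A) ^ r = a ^ r • A ^ r := by
  have h1 : (a • 1 : Matrix (Fin m) (Fin m) ℂ).PosDef := PosDef.one.smul ha
  have := h1.mul_rpow hA ((Commute.one_left A).smul_left a) r
  rwa [smul_one_rpow ha, smul_mul_assoc, smul_mul_assoc, one_mul, one_mul] at this

lemma det_re_pos (hA : A.PosDef) : 0 < A.det.re := (Complex.pos_iff.1 hA.det_pos).1

lemma det_eq_ofReal (hA : A.PosDef) : A.det = (A.det.re : ℂ) :=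
  Complex.ext rfl (Complex.pos_iff.1 hA.det_pos).2.symm

lemma det_re_eq_prod (hA : A.PosDef) : A.det.re = ∏ i, hA.1.eigenvalues i := by
  rw [hA.1.det_eq_prod_eigenvalues]
  norm_cast

lemma det_rpow (hA : A.PosDef) (r : ℝ) : (A ^ r).det.re = A.det.re ^ r := by
  rw [hA.det_re_eq_prod, ← Real.finsetProd_rpow _ _ fun i _ => (hA.eigenvalues_pos i).le,
    hA.rpow_eq, det_mul, det_mul, det_diagonal, mul_right_comm, ← det_mul]
  have : (hA.1.eigenvectorUnitary : Matrix (Fin m) (Fin m) ℂ) *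
    (hA.1.eigenvectorUnitary : Matrix (Fin m) (Fin m) ℂ)ᴴ = 1 :=
    Unitary.coe_mul_star_self hA.1.eigenvectorUnitary
  rw [this, det_one, one_mul]
  norm_cast

/-- `log det A ≤ tr A - m`. -/
lemma log_det_le (hA : A.PosDef) : Real.log A.det.re ≤ (trace A).re - m := by
  rw [hA.det_re_eq_prod, Real.log_prod fun i _ => (hA.eigenvalues_pos i).ne',
    hA.1.trace_eq_sum_eigenvalues, Complex.re_sum]
  have : (m : ℝ) = ∑ _i : Fin m, (1 : ℝ) := by simp
  rw [this, ← Finset.sum_sub_distrib]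
  exact Finset.sum_le_sum fun i _ => Real.log_le_sub_one_of_pos (hA.eigenvalues_pos i)

/-- A finite family of positive definite matrices has common positive scalar bounds. -/
lemma exists_bounds {n : ℕ} {K : Fin n → Matrix (Fin m) (Fin m) ℂ} (hK : ∀ j, (K j).PosDef) :
    ∃ c d : ℝ, 0 < c ∧ c ≤ d ∧ ∀ j, c • 1 ≤ K j ∧ K j ≤ d • 1 := by
  obtain ⟨d, hd⟩ := Finite.exists_le fun p : Fin n × Fin m => (hK p.1).1.eigenvalues p.2
  obtain ⟨c, hc⟩ := Finite.exists_le fun p : Fin n × Fin m => ((hK p.1).1.eigenvalues p.2)⁻¹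
  have hdec (j : Fin n) (a : ℝ) : K j - a • 1 =
      ((hK j).1.eigenvectorUnitary : Matrix (Fin m) (Fin m) ℂ) *
      diagonal (fun i => (((hK j).1.eigenvalues i - a : ℝ) : ℂ)) *
      ((hK j).1.eigenvectorUnitary : Matrix (Fin m) (Fin m) ℂ)ᴴ := by
    have h1 := (hK j).rpow_eq 1
    have hU' : ((hK j).1.eigenvectorUnitary : Matrix (Fin m) (Fin m) ℂ) *
      ((hK j).1.eigenvectorUnitary : Matrix (Fin m) (Fin m) ℂ)ᴴ = 1 :=
      Unitary.coe_mul_star_self (hK j).1.eigenvectorUnitary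
    simp only [Real.rpow_one] at h1
    rw [(hK j).rpow_one] at h1
    have h2 : diagonal (fun i => (((hK j).1.eigenvalues i - a : ℝ) : ℂ)) =
        diagonal (fun i => ((hK j).1.eigenvalues i : ℂ)) - a • 1 := by
      ext i k
      by_cases hik : i = k
      · subst hik; simp
      · simp [hik]
    rw [h2, mul_sub, sub_mul, ← h1, mul_smul_comm, smul_mul_assoc, mul_one, hU']
  -- The maxima with `1` keep the bounds positive and ordered even for an empty family, where `c`
  -- and `d` are arbitrary.
  refine ⟨(max c 1)⁻¹, max d 1, by positivity, ?_, fun j => ⟨?_, ?_⟩⟩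
  · exact (inv_le_one_of_one_le₀ (le_max_right _ _)).trans (le_max_right _ _)
  · rw [le_iff, hdec]
    refine PosSemidef.mul_mul_conjTranspose_same (posSemidef_diagonal_iff.2 fun i => ?_) _
    rw [Complex.zero_le_real, sub_nonneg]
    exact inv_le_of_inv_le₀ ((hK j).eigenvalues_pos i) ((hc (j, i)).trans (le_max_left _ _))
  · rw [le_iff, ← neg_sub, hdec, ← neg_mul, ← mul_neg, diagonal_neg]
    refine PosSemidef.mul_mul_conjTranspose_same (posSemidef_diagonal_iff.2 fun i => ?_) _
    rw [← Complex.ofReal_neg, Complex.zero_le_real, neg_sub, sub_nonneg]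
    exact (hd (j, i)).trans (le_max_left _ _)

lemma of_smul_one_le {a : ℝ} (ha : 0 < a) (h : a • 1 ≤ X) : X.PosDef := by
  have h1 : (a • 1 : Matrix (Fin m) (Fin m) ℂ).PosDef := PosDef.one.smul ha
  have := h1.add_posSemidef (le_iff.1 h)
  rwa [add_sub_cancel] at this

end Matrix.PosDef

/-! ### Tangent inequality for the objective -/

section Gradient

variable {m n : ℕ} {t : ℝ} {w : Fin n → ℝ} {A : Fin n → Matrix (Fin m) (Fin m) ℂ}
  {B X Y Z : Matrix (Fin m) (Fin m) ℂ}

/-- `t` times this matrix is the gradient of `sandwichedEntropy t A` at `X`. -/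
noncomputable def gradTerm (t : ℝ) (A X : Matrix (Fin m) (Fin m) ℂ) : Matrix (Fin m) (Fin m) ℂ :=
  A ^ ((1 - t) / (2 * t)) * (A ^ ((1 - t) / (2 * t)) * X * A ^ ((1 - t) / (2 * t))) ^ (t - 1) *
    A ^ ((1 - t) / (2 * t))

/-- The weighted sum of the matrices `gradTerm t (A j) X`. -/
noncomputable def gradSum (t : ℝ) (w : Fin n → ℝ) (A : Fin n → Matrix (Fin m) (Fin m) ℂ)
    (X : Matrix (Fin m) (Fin m) ℂ) : Matrix (Fin m) (Fin m) ℂ :=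
  ∑ j, w j • gradTerm t (A j) X

lemma gradTerm_posDef (hB : B.PosDef) (hX : X.PosDef) : (gradTerm t B X).PosDef :=
  (hB.rpow _).sandwich (((hB.rpow _).sandwich hX).rpow _)

lemma trace_sandwich_mul (S X N : Matrix (Fin m) (Fin m) ℂ) :
    Matrix.trace (S * X * S * N) = Matrix.trace (S * N * S * X) := by
  rw [mul_assoc (S * X), Matrix.trace_mul_comm, ← mul_assoc]

/-- Euler's identity for a function homogeneous of degree `t`: `P^t = P^(t-1) P` with `P = S X S`,
and the trace is cyclic. -/
lemma sandwichedEntropy_eq (hB : B.PosDef) (hX : X.PosDef) :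
    sandwichedEntropy t B X = (Matrix.trace (gradTerm t B X * X)).re := by
  have h := (hB.rpow ((1 - t) / (2 * t))).sandwich hX
  rw [gradTerm, ← trace_sandwich_mul, sandwichedEntropy]
  nth_rewrite 2 [← h.rpow_one]
  rw [← h.rpow_add, add_sub_cancel]

/-- Klein's inequality for `S X S` and `S Z S`; Euler's identity turns it into tangent form. In the
equality case the invertible `S` cancels. -/
lemma sandwichedEntropy_le_tangent (ht0 : 0 < t) (ht1 : t < 1) (hB : B.PosDef) (hX : X.PosDef)
    (hZ : Z.PosDef) :
    sandwichedEntropy t B X ≤ sandwichedEntropy t B Z +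
      t * (Matrix.trace (gradTerm t B Z * (X - Z))).re ∧
    (sandwichedEntropy t B X = sandwichedEntropy t B Z +
      t * (Matrix.trace (gradTerm t B Z * (X - Z))).re → X = Z) := by
  have hS := hB.rpow ((1 - t) / (2 * t))
  have h := (hS.sandwich hX).trace_rpow_le_tangent (hS.sandwich hZ) ht0 ht1
  have e : sandwichedEntropy t B Z + t * (Matrix.trace (gradTerm t B Z * (X - Z))).re =
      t * (Matrix.trace (B ^ ((1 - t) / (2 * t)) * X * B ^ ((1 - t) / (2 * t)) *
        (B ^ ((1 - t) / (2 * t)) * Z * B ^ ((1 - t) / (2 * t))) ^ (t - 1))).re +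
      (1 - t) * sandwichedEntropy t B Z := by
    rw [trace_sandwich_mul, mul_sub, Matrix.trace_sub, Complex.sub_re, ← sandwichedEntropy_eq hB hZ,
      gradTerm]
    ring
  rw [e]
  refine ⟨h.1, fun heq => ?_⟩
  have h2 := h.2 heq
  exact hS.isUnit.mul_left_cancel (hS.isUnit.mul_right_cancel h2)

lemma wassersteinObjective_eq (hw : w ∈ posProbVec n) : wassersteinObjective t w A X =
    (1 - t) * ∑ j, w j * (Matrix.trace (A j)).re + t * (Matrix.trace X).re -
      ∑ j, w j * sandwichedEntropy t (A j) X := by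
  have h : t * (Matrix.trace X).re = ∑ j, w j * (t * (Matrix.trace X).re) := by
    rw [← Finset.sum_mul, hw.2, one_mul]
  rw [h, Finset.mul_sum, ← Finset.sum_add_distrib, ← Finset.sum_sub_distrib, wassersteinObjective]
  refine Finset.sum_congr rfl fun j _ => ?_
  rw [Matrix.trace_add, Matrix.trace_smul, Matrix.trace_smul, Complex.add_re, Complex.smul_re,
    Complex.smul_re, smul_eq_mul, smul_eq_mul]
  ring

lemma trace_gradSum_mul (Y : Matrix (Fin m) (Fin m) ℂ) : (Matrix.trace (gradSum t w A X * Y)).re =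
    ∑ j, w j * (Matrix.trace (gradTerm t (A j) X * Y)).re := by
  rw [gradSum, Finset.sum_mul, Matrix.trace_sum, Complex.re_sum]
  refine Finset.sum_congr rfl fun j _ => ?_
  rw [smul_mul_assoc, Matrix.trace_smul, Complex.smul_re, smul_eq_mul]

/-- The objective function lies above its tangents, strictly so away from the point of contact. -/
theorem wassersteinObjective_tangent_le (ht0 : 0 < t) (ht1 : t < 1) (hw : w ∈ posProbVec n)
    (hA : ∀ j, (A j).PosDef) (hY : Y.PosDef) (hZ : Z.PosDef) :
    wassersteinObjective t w A Z + t * (Matrix.trace ((1 - gradSum t w A Z) * (Y - Z))).re ≤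
      wassersteinObjective t w A Y ∧
    (wassersteinObjective t w A Z + t * (Matrix.trace ((1 - gradSum t w A Z) * (Y - Z))).re =
      wassersteinObjective t w A Y → Y = Z) := by
  have key : wassersteinObjective t w A Y - (wassersteinObjective t w A Z +
      t * (Matrix.trace ((1 - gradSum t w A Z) * (Y - Z))).re) =
      ∑ j, w j * (sandwichedEntropy t (A j) Z +
        t * (Matrix.trace (gradTerm t (A j) Z * (Y - Z))).re - sandwichedEntropy t (A j) Y) := by
    rw [wassersteinObjective_eq hw, wassersteinObjective_eq hw, sub_mul 1 (gradSum t w A Z), one_mul, Matrix.trace_sub,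
      Complex.sub_re, trace_gradSum_mul, Matrix.trace_sub, Complex.sub_re]
    simp only [mul_sub, mul_add, Finset.sum_sub_distrib, Finset.sum_add_distrib, Finset.mul_sum,
      mul_left_comm t]
    ring
  have hnn (j) : 0 ≤ w j * (sandwichedEntropy t (A j) Z +
        t * (Matrix.trace (gradTerm t (A j) Z * (Y - Z))).re - sandwichedEntropy t (A j) Y) :=
    mul_nonneg (hw.1 j).le (sub_nonneg.2 (sandwichedEntropy_le_tangent ht0 ht1 (hA j) hY hZ).1)
  refine ⟨sub_nonneg.1 (key ▸ Finset.sum_nonneg fun j _ => hnn j), fun heq => ?_⟩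
  -- Strictness in one summand of positive weight is enough, and the weights summing to `1` provide
  -- one.
  have hne : Nonempty (Fin n) := by
    by_contra hn
    rw [not_nonempty_iff] at hn
    simpa using hw.2
  obtain ⟨j⟩ := hne
  rw [← heq, sub_self, eq_comm, Finset.sum_eq_zero_iff_of_nonneg fun j _ => hnn j] at key
  have hj := (mul_eq_zero.1 (key j (Finset.mem_univ j))).resolve_left (hw.1 j).ne'
  exact (sandwichedEntropy_le_tangent ht0 ht1 (hA j) hY hZ).2 (sub_eq_zero.1 hj).symm

/-- A critical point is the unique minimizer. -/
theorem isParamWassersteinMean_of_gradSum_eq_one (ht0 : 0 < t) (ht1 : t < 1)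
    (hw : w ∈ posProbVec n) (hA : ∀ j, (A j).PosDef) (hX : X.PosDef) (h : gradSum t w A X = 1) :
    IsParamWassersteinMean t w A X ∧ ∀ Y, IsParamWassersteinMean t w A Y → Y = X := by
  have key {Y : Matrix (Fin m) (Fin m) ℂ} (hY : Y.PosDef) :=
    wassersteinObjective_tangent_le ht0 ht1 hw hA hY hX
  rw [h] at key
  simp only [sub_self, zero_mul, Matrix.trace_zero, Complex.zero_re, mul_zero, add_zero] at key
  exact ⟨⟨hX, fun Y hY => (key hY).1⟩,
    fun Y hY => (key hY.1).2 (le_antisymm (key hY.1).1 (hY.2 hX))⟩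

/-! ### Existence of a critical point -/

lemma continuousOn_sandwich (hB : B.PosDef) (r : ℝ) :
    ContinuousOn (fun X => (B * X * B) ^ r) {X | X.PosDef} :=
  (Matrix.PosDef.continuousOn_rpow r).comp (by fun_prop) fun _ hX => hB.sandwich hX

lemma continuousOn_wassersteinObjective (hA : ∀ j, (A j).PosDef) :
    ContinuousOn (wassersteinObjective t w A) {X | X.PosDef} := by
  unfold wassersteinObjective sandwichedEntropy
  refine continuousOn_finsetSum _ fun j _ => continuousOn_const.mul (ContinuousOn.sub ?_ ?_)
  · exact (Complex.continuous_re.comp (Continuous.matrix_trace (by fun_prop))).continuousOn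
  · exact (Complex.continuous_re.comp (Continuous.matrix_trace continuous_id)).comp_continuousOn
      (continuousOn_sandwich ((hA j).rpow _) t)

lemma continuousOn_gradSum (hA : ∀ j, (A j).PosDef) :
    ContinuousOn (gradSum t w A) {X | X.PosDef} := by
  unfold gradSum gradTerm
  have h (j) := (continuousOn_const (c := A j ^ ((1 - t) / (2 * t)))).mul
    (continuousOn_sandwich ((hA j).rpow ((1 - t) / (2 * t))) (t - 1))
  exact continuousOn_finsetSum _ fun j _ => ((h j).mul continuousOn_const).const_smul (w j)

/-- With `S = B^((1-t)/(2t))`, the matrix `T = C S` intertwines `S C² S` with `C S² C`. Moving the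
power `t - 1` across `T` leaves `(C S² C)^(t-1) (C S² C)`. -/
lemma gradTerm_conj (ht0 : 0 < t) (hB : B.PosDef) {C : Matrix (Fin m) (Fin m) ℂ} (hC : C.PosDef) :
    C * gradTerm t B (C * C) * C = (C * B ^ ((1 - t) / t) * C) ^ t := by
  have hS := hB.rpow ((1 - t) / (2 * t))
  have hK : B ^ ((1 - t) / t) = B ^ ((1 - t) / (2 * t)) * B ^ ((1 - t) / (2 * t)) := by
    rw [← hB.rpow_add]; congr 1; field_simp; ring
  have hCC : (C * C).PosDef := hC.mul_of_commute hC (Commute.refl C)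
  have h1 := hS.sandwich hCC
  have h2 := hC.sandwich (hB.rpow ((1 - t) / t))
  rw [gradTerm]
  have h3 := h1.intertwine_rpow h2 (T := C * B ^ ((1 - t) / (2 * t)))
    (by rw [hK]; simp only [mul_assoc]) (t - 1)
  calc _ = C * B ^ ((1 - t) / (2 * t)) * (B ^ ((1 - t) / (2 * t)) * (C * C) *
        B ^ ((1 - t) / (2 * t))) ^ (t - 1) * (B ^ ((1 - t) / (2 * t)) * C) := by
        simp only [mul_assoc]
    _ = (C * B ^ ((1 - t) / t) * C) ^ (t - 1) * (C * B ^ ((1 - t) / t) * C) ^ (1 : ℝ) := by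
        rw [h3, h2.rpow_one]
        nth_rewrite 3 [hK]
        simp only [mul_assoc]
    _ = _ := by rw [← h2.rpow_add, sub_add_cancel]

lemma smul_one_le_smul_one {a b : ℝ} (h : a ≤ b) :
    (a • 1 : Matrix (Fin m) (Fin m) ℂ) ≤ b • 1 := by
  rw [Matrix.le_iff, ← sub_smul]
  exact Matrix.PosSemidef.one.smul (sub_nonneg.2 h)

lemma Matrix.conj_le_conj {C : Matrix (Fin m) (Fin m) ℂ} (hC : C.IsHermitian) (h : X ≤ Y) :
    C * X * C ≤ C * Y * C := by
  have := (Matrix.le_iff.1 h).mul_mul_conjTranspose_same C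
  rw [hC.eq, mul_sub, sub_mul] at this
  exact Matrix.le_iff.2 this

/-- From `c ≤ K ≤ d` follows `c C² ≤ C K C ≤ d C²`; operator monotonicity of `x ↦ x^t` then
preserves the interval, its endpoints being fixed points of `s ↦ (c s)^t` and `s ↦ (d s)^t`. -/
lemma conj_rpow_mem_Icc (ht0 : 0 < t) (ht1 : t < 1) {K C : Matrix (Fin m) (Fin m) ℂ} {c d : ℝ}
    (hc : 0 < c) (hd : 0 < d) (hK : c • 1 ≤ K ∧ K ≤ d • 1) (hC : C.PosDef)
    (hX : C * C ∈ Set.Icc (c ^ (t / (1 - t)) • 1) (d ^ (t / (1 - t)) • 1)) :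
    (C * K * C) ^ t ∈ Set.Icc (c ^ (t / (1 - t)) • 1 : Matrix (Fin m) (Fin m) ℂ)
      (d ^ (t / (1 - t)) • 1) := by
  have ht : t ∈ Set.Icc (0 : ℝ) 1 := ⟨ht0.le, ht1.le⟩
  have hpow {e : ℝ} (he : 0 < e) :
      ((e * e ^ (t / (1 - t))) • 1 : Matrix (Fin m) (Fin m) ℂ) ^ t = e ^ (t / (1 - t)) • 1 := by
    rw [Matrix.PosDef.smul_one_rpow (by positivity)]
    nth_rewrite 1 [← Real.rpow_one e]
    rw [← Real.rpow_add he, ← Real.rpow_mul he.le]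
    have h1 : 1 - t ≠ 0 := (sub_pos.2 ht1).ne'
    congr 2
    field_simp
    ring
  have hconj (e : ℝ) : C * (e • 1) * C = e • (C * C) := by simp
  have hsm {e : ℝ} (he : 0 < e) {P Q : Matrix (Fin m) (Fin m) ℂ} (h : P ≤ Q) : e • P ≤ e • Q := by
    rw [Matrix.le_iff, ← smul_sub]
    exact (Matrix.le_iff.1 h).smul he.le
  constructor
  · rw [← hpow hc]
    refine Matrix.PosDef.rpow_le_rpow_of_le ?_ ht
    refine le_trans ?_ (Matrix.conj_le_conj hC.1 hK.1)
    rw [hconj, ← smul_smul]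
    exact hsm hc hX.1
  · rw [← hpow hd]
    refine Matrix.PosDef.rpow_le_rpow_of_le ?_ ht
    refine (Matrix.conj_le_conj hC.1 hK.2).trans ?_
    rw [hconj, ← smul_smul]
    exact hsm hd hX.2

/-- A Hermitian `Q` with `tr (Q C Q C) ≤ 0` for a positive definite `C` vanishes. -/
lemma Matrix.PosDef.eq_zero_of_trace_mul_le {C Q : Matrix (Fin m) (Fin m) ℂ} (hC : C.PosDef)
    (hQ : Q.IsHermitian) (h : (Matrix.trace (Q * (C * Q * C))).re ≤ 0) : Q = 0 := by
  have hD := hC.rpow (1 / 2)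
  have hDD : C ^ (1 / 2 : ℝ) * C ^ (1 / 2 : ℝ) = C := by
    rw [← hC.rpow_add, add_halves, hC.rpow_one]
  set D := C ^ (1 / 2 : ℝ)
  have hN : (D * Q * D).IsHermitian := by
    have := Matrix.isHermitian_mul_mul_conjTranspose D hQ
    rwa [hD.1.eq] at this
  have e : Matrix.trace (D * Q * D * (D * Q * D)) = Matrix.trace (Q * (C * Q * C)) := by
    rw [mul_assoc D Q D, mul_assoc D, Matrix.trace_mul_comm, ← hDD]
    simp only [mul_assoc]
  have h0 : D * Q * D = 0 := by
    refine eq_zero_of_trace_mul_self_re_eq_zero hN (le_antisymm (e ▸ h) ?_)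
    have := (Matrix.posSemidef_conjTranspose_mul_self (D * Q * D)).trace_nonneg
    rw [hN.eq] at this
    exact (Complex.nonneg_iff.1 this).1
  have h1 : D * Q * D = D * 0 * D := by rw [h0]; simp
  exact hD.isUnit.mul_left_cancel (hD.isUnit.mul_right_cancel h1)

lemma sum_smul_mem_Icc {a b : ℝ} (hw : w ∈ posProbVec n) {G : Fin n → Matrix (Fin m) (Fin m) ℂ}
    (hG : ∀ j, G j ∈ Set.Icc (a • 1 : Matrix (Fin m) (Fin m) ℂ) (b • 1)) :
    ∑ j, w j • G j ∈ Set.Icc (a • 1 : Matrix (Fin m) (Fin m) ℂ) (b • 1) := by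
  have h (M : Matrix (Fin m) (Fin m) ℂ) : M = ∑ j, w j • M := by
    rw [← Finset.sum_smul, hw.2, one_smul]
  constructor
  · rw [h (a • 1), Matrix.le_iff, ← Finset.sum_sub_distrib]
    refine Matrix.posSemidef_sum _ fun j _ => ?_
    rw [← smul_sub]
    exact (Matrix.le_iff.1 (hG j).1).smul (hw.1 j).le
  · rw [h (b • 1), Matrix.le_iff, ← Finset.sum_sub_distrib]
    refine Matrix.posSemidef_sum _ fun j _ => ?_
    rw [← smul_sub]
    exact (Matrix.le_iff.1 (hG j).2).smul (hw.1 j).le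

lemma segment_mem_Icc {a b ε : ℝ} (h0 : 0 ≤ ε) (h1 : ε ≤ 1)
    (hX : X ∈ Set.Icc (a • 1 : Matrix (Fin m) (Fin m) ℂ) (b • 1))
    (hY : Y ∈ Set.Icc (a • 1 : Matrix (Fin m) (Fin m) ℂ) (b • 1)) :
    X + ε • (Y - X) ∈ Set.Icc (a • 1 : Matrix (Fin m) (Fin m) ℂ) (b • 1) := by
  constructor
  · rw [Matrix.le_iff]
    have : X + ε • (Y - X) - a • 1 = (1 - ε) • (X - a • 1) + ε • (Y - a • 1) := by module
    rw [this]
    exact ((Matrix.le_iff.1 hX.1).smul (sub_nonneg.2 h1)).add ((Matrix.le_iff.1 hY.1).smul h0)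
  · rw [Matrix.le_iff]
    have : b • 1 - (X + ε • (Y - X)) = (1 - ε) • (b • 1 - X) + ε • (b • 1 - Y) := by module
    rw [this]
    exact ((Matrix.le_iff.1 hX.2).smul (sub_nonneg.2 h1)).add ((Matrix.le_iff.1 hY.2).smul h0)

/-- First-order condition at a minimizer over an interval of matrices. -/
lemma trace_gradient_mul_nonneg (ht0 : 0 < t) (ht1 : t < 1) (hw : w ∈ posProbVec n)
    (hA : ∀ j, (A j).PosDef) {a b : ℝ} (ha : 0 < a)
    (hX : X ∈ Set.Icc (a • 1 : Matrix (Fin m) (Fin m) ℂ) (b • 1))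
    (hmin : IsMinOn (wassersteinObjective t w A) (Set.Icc (a • 1) (b • 1)) X)
    (hY : Y ∈ Set.Icc (a • 1 : Matrix (Fin m) (Fin m) ℂ) (b • 1)) :
    0 ≤ (Matrix.trace ((1 - gradSum t w A X) * (Y - X))).re := by
  have hpd (ε : ℝ) (hε : ε ∈ Set.Icc (0 : ℝ) 1) := segment_mem_Icc hε.1 hε.2 hX hY
  have hcont : ContinuousOn (fun ε : ℝ => (Matrix.trace
      ((1 - gradSum t w A (X + ε • (Y - X))) * (Y - X))).re) (Set.Icc 0 1) := by
    have h1 : ContinuousOn (fun ε : ℝ => gradSum t w A (X + ε • (Y - X))) (Set.Icc 0 1) :=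
      (continuousOn_gradSum hA).comp (by fun_prop)
        fun ε hε => Matrix.PosDef.of_smul_one_le ha (hpd ε hε).1
    exact (Complex.continuous_re.comp (Continuous.matrix_trace continuous_id)).comp_continuousOn
      ((continuousOn_const.sub h1).mul continuousOn_const)
  have hlim := (hcont 0 (by simp)).tendsto.mono_left
    (nhdsWithin_mono 0 (Set.Ioc_subset_Icc_self (a := (0 : ℝ)) (b := 1)))
  simp only [zero_smul, add_zero] at hlim
  have : (nhdsWithin (0 : ℝ) (Set.Ioc 0 1)).NeBot := by
    rw [nhdsWithin_Ioc_eq_nhdsGT one_pos]; infer_instance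
  refine ge_of_tendsto hlim (eventually_nhdsWithin_of_forall fun ε hε => ?_)
  have hm := hpd ε ⟨hε.1.le, hε.2⟩
  -- The tangent is taken at the moved point and evaluated at `X`, so minimality signs the gradient
  -- there; continuity carries the sign to `ε = 0`.
  have h1 := (wassersteinObjective_tangent_le ht0 ht1 hw hA (Matrix.PosDef.of_smul_one_le ha hX.1)
    (Matrix.PosDef.of_smul_one_le ha hm.1)).1
  have h2 : wassersteinObjective t w A X ≤ wassersteinObjective t w A (X + ε • (Y - X)) := hmin hm
  have h3 : X - (X + ε • (Y - X)) = (-ε) • (Y - X) := by module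
  rw [h3, mul_smul_comm, Matrix.trace_smul, Complex.smul_re, smul_eq_mul] at h1
  have h4 : 0 ≤ (t * ε) * (Matrix.trace ((1 - gradSum t w A (X + ε • (Y - X))) * (Y - X))).re := by
    linarith
  exact nonneg_of_mul_nonneg_right h4 (mul_pos ht0 hε.1)

/-- A minimizer over an interval could lie on its boundary. The self-map of the interval supplies a
test direction that still forces the full gradient to vanish. -/
theorem exists_gradSum_eq_one (ht0 : 0 < t) (ht1 : t < 1) (hw : w ∈ posProbVec n)
    (hA : ∀ j, (A j).PosDef) : ∃ X, X.PosDef ∧ gradSum t w A X = 1 := by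
  obtain ⟨c, d, hc, hcd, hK⟩ :=
    Matrix.PosDef.exists_bounds fun j => (hA j).rpow ((1 - t) / t)
  have hd := hc.trans_le hcd
  set a := c ^ (t / (1 - t))
  set b := d ^ (t / (1 - t))
  have ha : 0 < a := Real.rpow_pos_of_pos hc _
  have hab : a ≤ b := Real.rpow_le_rpow hc.le hcd (div_nonneg ht0.le (sub_nonneg.2 ht1.le))
  obtain ⟨X, hX, hmin⟩ := (Matrix.PosDef.isCompact_Icc (m := m) a b).exists_isMinOn
    ⟨a • 1, le_rfl, smul_one_le_smul_one hab⟩ ((continuousOn_wassersteinObjective (t := t) (w := w)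
      hA).mono fun X hX => Matrix.PosDef.of_smul_one_le ha hX.1)
  have hXp := Matrix.PosDef.of_smul_one_le ha hX.1
  refine ⟨X, hXp, ?_⟩
  have hC := hXp.rpow (1 / 2)
  have hCC : X ^ (1 / 2 : ℝ) * X ^ (1 / 2 : ℝ) = X := by
    rw [← hXp.rpow_add, add_halves, hXp.rpow_one]
  set C := X ^ (1 / 2 : ℝ)
  have hY : C * gradSum t w A X * C ∈ Set.Icc (a • 1 : Matrix (Fin m) (Fin m) ℂ) (b • 1) := by
    rw [gradSum, Finset.mul_sum, Finset.sum_mul]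
    simp only [mul_smul_comm, smul_mul_assoc]
    refine sum_smul_mem_Icc hw fun j => ?_
    rw [← hCC, gradTerm_conj ht0 (hA j) hC]
    exact conj_rpow_mem_Icc ht0 ht1 hc hd (hK j) hC (by rwa [hCC])
  have h := trace_gradient_mul_nonneg ht0 ht1 hw hA ha hX hmin hY
  have hherm : (1 - gradSum t w A X).IsHermitian := by
    refine Matrix.isHermitian_one.sub (Matrix.posSemidef_sum _ fun j _ => ?_).1
    exact (gradTerm_posDef (hA j) hXp).posSemidef.smul (hw.1 j).le
  refine (sub_eq_zero.1 (hC.eq_zero_of_trace_mul_le hherm ?_)).symm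
  -- The test direction is minus the gradient factor conjugated by `C`, so the first-order condition
  -- is a sign condition on a square.
  have e : C * gradSum t w A X * C - X = -(C * (1 - gradSum t w A X) * C) := by
    rw [mul_sub, sub_mul, mul_one, hCC, neg_sub]
  rw [e, mul_neg, Matrix.trace_neg, Complex.neg_re] at h
  linarith

/-- The minimizer exists, is unique and is characterized by the critical equation. -/
theorem paramWassersteinMean_spec (ht0 : 0 < t) (ht1 : t < 1) (hw : w ∈ posProbVec n)
    (hA : ∀ j, (A j).PosDef) : IsParamWassersteinMean t w A (paramWassersteinMean t w A) ∧
      (∀ X, IsParamWassersteinMean t w A X → X = paramWassersteinMean t w A) ∧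
      gradSum t w A (paramWassersteinMean t w A) = 1 := by
  obtain ⟨X, hX, hg⟩ := exists_gradSum_eq_one ht0 ht1 hw hA
  obtain ⟨h1, h2⟩ := isParamWassersteinMean_of_gradSum_eq_one ht0 ht1 hw hA hX hg
  have hex : ∃ X, IsParamWassersteinMean t w A X := ⟨X, h1⟩
  have h3 : paramWassersteinMean t w A = X := by
    rw [paramWassersteinMean, dif_pos hex]
    exact h2 _ hex.choose_spec
  rw [h3]
  exact ⟨h1, h2, hg⟩

/-- Identifying the mean now amounts to substituting a positive definite candidate into the critical
equation. -/
lemma eq_paramWassersteinMean_iff (ht0 : 0 < t) (ht1 : t < 1) (hw : w ∈ posProbVec n)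
    (hA : ∀ j, (A j).PosDef) (hX : X.PosDef) :
    X = paramWassersteinMean t w A ↔ gradSum t w A X = 1 := by
  obtain ⟨-, h2, h3⟩ := paramWassersteinMean_spec ht0 ht1 hw hA
  exact ⟨fun h => h ▸ h3,
    fun h => h2 X (isParamWassersteinMean_of_gradSum_eq_one ht0 ht1 hw hA hX h).1⟩

end Gradient

/-! ### The properties, read off the critical equation -/

section Properties

variable {m n : ℕ} {t : ℝ} {w : Fin n → ℝ} {A : Fin n → Matrix (Fin m) (Fin m) ℂ}
  {B X Y Z : Matrix (Fin m) (Fin m) ℂ}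

lemma gradTerm_of_commute (ht0 : 0 < t) (hB : B.PosDef) (hX : X.PosDef) (h : Commute B X) :
    gradTerm t B X = B ^ (1 - t) * X ^ (t - 1) := by
  have hS := hB.rpow ((1 - t) / (2 * t))
  have hSX : Commute (B ^ ((1 - t) / (2 * t))) X := (hB.rpow_commute h.symm _).symm
  have h1 : B ^ ((1 - t) / (2 * t)) * X * B ^ ((1 - t) / (2 * t)) =
      B ^ ((1 - t) / t) * X := by
    rw [mul_assoc, ← hSX.eq, ← mul_assoc, ← hB.rpow_add]
    congr 2; field_simp; ring
  have h2 : Commute (B ^ ((1 - t) / t)) X := (hB.rpow_commute h.symm _).symm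
  have h3 : Commute (B ^ ((1 - t) / (2 * t))) (X ^ (t - 1)) := hX.rpow_commute hSX _
  rw [gradTerm, h1, (hB.rpow _).mul_rpow hX h2]
  -- `rpow_rpow` needs a nonzero inner exponent; it vanishes only at `t = 1`, where both sides are
  -- `1`.
  by_cases h0 : (1 - t) / t = 0
  · have ht : t = 1 := by
      rcases div_eq_zero_iff.1 h0 with h | h
      · linarith
      · exact absurd h ht0.ne'
    subst ht
    simp [hB.rpow_zero, hX.rpow_zero]
  rw [hB.rpow_rpow h0, mul_assoc, mul_assoc, ← h3.eq, ← mul_assoc, ← mul_assoc, ← hB.rpow_add,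
    ← hB.rpow_add]
  congr 2; field_simp; ring

lemma gradTerm_self (ht0 : 0 < t) (hX : X.PosDef) : gradTerm t X X = 1 := by
  rw [gradTerm_of_commute ht0 hX hX (Commute.refl X), ← hX.rpow_add, sub_add_sub_cancel', sub_self,
    hX.rpow_zero]

/-- The degree in `α` is `2s + (2s + 1)(t - 1)` with `s = (1-t)/(2t)`, which is zero. -/
lemma gradTerm_smul (ht0 : 0 < t) (hB : B.PosDef) (hX : X.PosDef) {α : ℝ} (hα : 0 < α) :
    gradTerm t (α • B) (α • X) = gradTerm t B X := by
  have h := (hB.rpow ((1 - t) / (2 * t))).sandwich hX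
  rw [gradTerm, hB.smul_rpow hα]
  simp only [smul_mul_assoc, mul_smul_comm, smul_smul]
  rw [h.smul_rpow (by positivity)]
  simp only [smul_mul_assoc, mul_smul_comm, smul_smul]
  rw [gradTerm]
  convert one_smul ℝ _
  set s := (1 - t) / (2 * t) with hs
  have e : α ^ s * (α * α ^ s) = α ^ (2 * s + 1) := by
    nth_rewrite 2 [← Real.rpow_one α]
    rw [← Real.rpow_add hα, ← Real.rpow_add hα]; congr 1; ring
  simp only [e, ← Real.rpow_mul hα.le, ← Real.rpow_add hα]
  refine Eq.trans ?_ (Real.rpow_zero α)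
  congr 1
  rw [hs]
  field_simp
  ring

lemma gradTerm_unitary_conj (hB : B.PosDef) (hX : X.PosDef) {U : Matrix (Fin m) (Fin m) ℂ}
    (hU : U ∈ Matrix.unitaryGroup (Fin m) ℂ) :
    gradTerm t (U * B * Uᴴ) (U * X * Uᴴ) = U * gradTerm t B X * Uᴴ := by
  have h1 : Uᴴ * U = 1 := Matrix.mem_unitaryGroup_iff'.1 hU
  have hmul (P Q : Matrix (Fin m) (Fin m) ℂ) : U * P * Uᴴ * (U * Q * Uᴴ) = U * (P * Q) * Uᴴ := by
    rw [mul_assoc (U * P), mul_assoc U Q, ← mul_assoc Uᴴ, h1, one_mul]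
    simp only [mul_assoc]
  rw [gradTerm, hB.unitary_conj_rpow hU, hmul, hmul,
    ((hB.rpow _).sandwich hX).unitary_conj_rpow hU, hmul, hmul, gradTerm]

lemma sum_smul_posDef (hw : w ∈ posProbVec n) (hA : ∀ j, (A j).PosDef) :
    (∑ j, w j • A j).PosDef := by
  have hne : (Finset.univ : Finset (Fin n)).Nonempty := by
    by_contra hn
    rw [Finset.not_nonempty_iff_eq_empty] at hn
    simpa [hn] using hw.2
  exact Matrix.posDef_sum hne fun j _ => (hA j).smul (hw.1 j)

/-- With `Q = ∑ w_j A_j^(1-t)`, the candidate `Q^(1/(1-t))` commutes with every `A_i`, so `gradSum`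
collapses to `Q Q⁻¹`. -/
theorem paramWassersteinMean_of_commute (ht0 : 0 < t) (ht1 : t < 1) (hw : w ∈ posProbVec n)
    (hA : ∀ j, (A j).PosDef) (hcomm : ∀ i j, Commute (A i) (A j)) :
    paramWassersteinMean t w A = (∑ j, w j • A j ^ (1 - t)) ^ (1 / (1 - t)) := by
  have hQ := sum_smul_posDef hw fun j => (hA j).rpow (1 - t)
  have hX := hQ.rpow (1 / (1 - t))
  have h1 : 1 - t ≠ 0 := (sub_pos.2 ht1).ne'
  refine ((eq_paramWassersteinMean_iff ht0 ht1 hw hA hX).2 ?_).symm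
  have hc (i : Fin n) : Commute (A i) ((∑ j, w j • A j ^ (1 - t)) ^ (1 / (1 - t))) :=
    hQ.rpow_commute (Commute.sum_right _ _ _ fun j _ =>
      ((hA j).rpow_commute (hcomm i j) _).smul_right _) _
  rw [gradSum, Finset.sum_congr rfl fun j _ => by
    rw [gradTerm_of_commute ht0 (hA j) hX (hc j), ← smul_mul_assoc]]
  rw [← Finset.sum_mul, hQ.rpow_rpow (one_div_ne_zero h1)]
  nth_rewrite 1 [← hQ.rpow_one]
  rw [← hQ.rpow_add]
  have : 1 + 1 / (1 - t) * (t - 1) = 0 := by field_simp; ring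
  rw [this, hQ.rpow_zero]

theorem paramWassersteinMean_smul (ht0 : 0 < t) (ht1 : t < 1) (hw : w ∈ posProbVec n)
    (hA : ∀ j, (A j).PosDef) {α : ℝ} (hα : 0 < α) :
    paramWassersteinMean t w (fun j => α • A j) = α • paramWassersteinMean t w A := by
  obtain ⟨h, -, hg⟩ := paramWassersteinMean_spec ht0 ht1 hw hA
  refine ((eq_paramWassersteinMean_iff ht0 ht1 hw (fun j => (hA j).smul hα)
    (h.1.smul hα)).2 ?_).symm
  rw [← hg]
  exact Finset.sum_congr rfl fun j _ => by rw [gradTerm_smul ht0 (hA j) h.1 hα]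

theorem paramWassersteinMean_perm (ht0 : 0 < t) (ht1 : t < 1) (hw : w ∈ posProbVec n)
    (hA : ∀ j, (A j).PosDef) (σ : Equiv.Perm (Fin n)) :
    paramWassersteinMean t (fun j => w (σ j)) (fun j => A (σ j)) = paramWassersteinMean t w A := by
  obtain ⟨h, -, hg⟩ := paramWassersteinMean_spec ht0 ht1 hw hA
  refine ((eq_paramWassersteinMean_iff ht0 ht1
    ⟨fun j => hw.1 (σ j), (Equiv.sum_comp σ w).trans hw.2⟩ (fun j => hA (σ j)) h.1).2 ?_).symm
  rw [← hg]
  exact Equiv.sum_comp σ fun j => w j • gradTerm t (A j) (paramWassersteinMean t w A)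

lemma sum_repeat {M : Type*} [AddCommMonoid M] (p : ℕ) (f : Fin n → M) :
    ∑ k, Fin.repeat p f k = p • ∑ j, f j := by
  rw [← finProdFinEquiv.sum_comp, Fintype.sum_prod_type]
  have h (i : Fin p) (j : Fin n) : Fin.repeat p f (finProdFinEquiv (i, j)) = f j := by
    rw [Fin.repeat_apply]
    exact congrArg (fun x => f x.2) (finProdFinEquiv.symm_apply_apply (i, j))
  simp only [h, Finset.sum_const, Finset.card_univ, Fintype.card_fin]

theorem paramWassersteinMean_repeat (ht0 : 0 < t) (ht1 : t < 1) (hw : w ∈ posProbVec n)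
    (hA : ∀ j, (A j).PosDef) {p : ℕ} (hp : 1 ≤ p) :
    paramWassersteinMean t (fun k => 1 / (p : ℝ) * Fin.repeat p w k) (Fin.repeat p A) =
      paramWassersteinMean t w A := by
  obtain ⟨h, -, hg⟩ := paramWassersteinMean_spec ht0 ht1 hw hA
  have hp0 : (0 : ℝ) < p := Nat.cast_pos.2 hp
  refine ((eq_paramWassersteinMean_iff ht0 ht1 ⟨fun k => ?_, ?_⟩ (fun k => ?_) h.1).2 ?_).symm
  · exact mul_pos (one_div_pos.2 hp0) (hw.1 _)
  · rw [← Finset.mul_sum, sum_repeat, hw.2, nsmul_eq_mul, mul_one, one_div_mul_cancel hp0.ne']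
  · exact hA _
  · rw [gradSum]
    simp only [mul_smul]
    rw [← Finset.smul_sum]
    have := sum_repeat p fun j => w j • gradTerm t (A j) (paramWassersteinMean t w A)
    rw [← gradSum, hg] at this
    refine (congrArg _ this).trans ?_
    rw [← Nat.cast_smul_eq_nsmul ℝ, smul_smul, one_div_mul_cancel hp0.ne', one_smul]

theorem paramWassersteinMean_unitary_conj (ht0 : 0 < t) (ht1 : t < 1) (hw : w ∈ posProbVec n)
    (hA : ∀ j, (A j).PosDef) {U : Matrix (Fin m) (Fin m) ℂ}
    (hU : U ∈ Matrix.unitaryGroup (Fin m) ℂ) :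
    paramWassersteinMean t w (fun j => U * A j * Uᴴ) = U * paramWassersteinMean t w A * Uᴴ := by
  obtain ⟨h, -, hg⟩ := paramWassersteinMean_spec ht0 ht1 hw hA
  have h2 : U * Uᴴ = 1 := Matrix.mem_unitaryGroup_iff.1 hU
  have hpd {B : Matrix (Fin m) (Fin m) ℂ} (hB : B.PosDef) : (U * B * Uᴴ).PosDef :=
    hB.mul_mul_conjTranspose_same
      (Matrix.vecMul_injective_of_isUnit (IsUnit.of_mul_eq_one _ h2))
  refine ((eq_paramWassersteinMean_iff ht0 ht1 hw (fun j => hpd (hA j)) (hpd h.1)).2 ?_).symm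
  rw [gradSum, Finset.sum_congr rfl fun j _ => by
    rw [gradTerm_unitary_conj (hA j) h.1 hU, ← smul_mul_assoc, ← mul_smul_comm]]
  rw [← Finset.sum_mul, ← Finset.mul_sum, ← gradSum, hg, mul_one, h2]

/-- The determinant ignores the order of factors: `det B` gets exponent `(1-t)/t + (t-1)(1-t)/t =
1-t`, and `det X` gets `t-1`. -/
lemma log_det_gradTerm (ht0 : 0 < t) (hB : B.PosDef) (hX : X.PosDef) :
    Real.log (gradTerm t B X).det.re =
      (1 - t) * (Real.log B.det.re - Real.log X.det.re) := by
  have hS := hB.rpow ((1 - t) / (2 * t))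
  have h := hS.sandwich hX
  have hs0 := hS.det_re_pos
  have hx0 := hX.det_re_pos
  have hdet {C : Matrix (Fin m) (Fin m) ℂ} (hC : C.PosDef) :
      (B ^ ((1 - t) / (2 * t)) * C * B ^ ((1 - t) / (2 * t))).det.re =
      B.det.re ^ ((1 - t) / (2 * t)) * B.det.re ^ ((1 - t) / (2 * t)) * C.det.re := by
    rw [Matrix.det_mul_right_comm, Matrix.det_mul, ← hB.rpow_add,
      (hB.rpow _).det_eq_ofReal, Complex.re_ofReal_mul, hB.det_rpow, Real.rpow_add hB.det_re_pos]
  have hb := Real.rpow_pos_of_pos hB.det_re_pos ((1 - t) / (2 * t))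
  rw [gradTerm, hdet (h.rpow _), h.det_rpow, hdet hX,
    Real.log_mul (by positivity) (Real.rpow_pos_of_pos (by positivity) _).ne',
    Real.log_rpow (by positivity), Real.log_mul (by positivity) hx0.ne',
    Real.log_mul hb.ne' hb.ne', Real.log_rpow hB.det_re_pos]
  field_simp
  ring

theorem prod_det_rpow_le_det_paramWassersteinMean (ht0 : 0 < t) (ht1 : t < 1)
    (hw : w ∈ posProbVec n) (hA : ∀ j, (A j).PosDef) :
    ∏ j, (A j).det.re ^ w j ≤ (paramWassersteinMean t w A).det.re := by
  obtain ⟨h, -, hg⟩ := paramWassersteinMean_spec ht0 ht1 hw hA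
  set X := paramWassersteinMean t w A
  have hX : X.PosDef := h.1
  have hpos (j) : 0 < (A j).det.re ^ w j := Real.rpow_pos_of_pos (hA j).det_re_pos _
  rw [← Real.log_le_log_iff (Finset.prod_pos fun j _ => hpos j) hX.det_re_pos,
    Real.log_prod fun j _ => (hpos j).ne']
  -- Trace of the critical equation; it makes the averaged bound `log det ≤ tr - m` have right side
  -- zero.
  have htr : ∑ j, w j * (Matrix.trace (gradTerm t (A j) X)).re = m := by
    have := trace_gradSum_mul (t := t) (w := w) (A := A) (X := X) 1
    rw [hg] at this
    simpa using this.symm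
  have hle : ∑ j, w j * Real.log (gradTerm t (A j) X).det.re ≤ 0 := by
    calc _ ≤ ∑ j, w j * ((Matrix.trace (gradTerm t (A j) X)).re - m) :=
          Finset.sum_le_sum fun j _ => mul_le_mul_of_nonneg_left
            (gradTerm_posDef (hA j) hX).log_det_le (hw.1 j).le
      _ = 0 := by
          simp only [mul_sub, Finset.sum_sub_distrib]
          rw [htr, ← Finset.sum_mul, hw.2, one_mul, sub_self]
  have e : ∑ j, w j * Real.log (gradTerm t (A j) X).det.re =
      (1 - t) * (∑ j, Real.log ((A j).det.re ^ w j) - Real.log X.det.re) := by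
    have : Real.log X.det.re = ∑ j, w j * Real.log X.det.re := by
      rw [← Finset.sum_mul, hw.2, one_mul]
    rw [this, ← Finset.sum_sub_distrib, Finset.mul_sum]
    refine Finset.sum_congr rfl fun j _ => ?_
    rw [log_det_gradTerm ht0 (hA j) hX, Real.log_rpow (hA j).det_re_pos]
    ring
  rw [e] at hle
  linarith [nonpos_of_mul_nonpos_right hle (sub_pos.2 ht1)]

lemma posProbVec_init (hn : 1 ≤ n) {w : Fin (n + 1) → ℝ} (hw : w ∈ posProbVec (n + 1)) :
    0 < 1 - w (Fin.last n) ∧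
      (fun j : Fin n => 1 / (1 - w (Fin.last n)) * w j.castSucc) ∈ posProbVec n := by
  have hsum : ∑ j : Fin n, w j.castSucc = 1 - w (Fin.last n) := by
    rw [eq_sub_iff_add_eq, ← Fin.sum_univ_castSucc, hw.2]
  have hpos : 0 < 1 - w (Fin.last n) := by
    rw [← hsum]
    exact Finset.sum_pos (fun j _ => hw.1 _) ⟨⟨0, hn⟩, Finset.mem_univ _⟩
  refine ⟨hpos, fun j => mul_pos (one_div_pos.2 hpos) (hw.1 _), ?_⟩
  rw [← Finset.mul_sum, hsum, one_div_mul_cancel hpos.ne']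

/-- The appended argument contributes `w_n • 1` to `gradSum` at `X`, by `gradTerm_self`. Subtracting
it and dividing by `1 - w_n` gives the critical equation for the renormalized weights. -/
theorem eq_paramWassersteinMean_snoc_iff (ht0 : 0 < t) (ht1 : t < 1) (hn : 1 ≤ n)
    {w : Fin (n + 1) → ℝ} (hw : w ∈ posProbVec (n + 1)) (hA : ∀ j, (A j).PosDef)
    (hX : X.PosDef) :
    X = paramWassersteinMean t w (Fin.snoc (α := fun _ => Matrix (Fin m) (Fin m) ℂ) A X) ↔
      X = paramWassersteinMean t
        (fun j : Fin n => 1 / (1 - w (Fin.last n)) * w j.castSucc) A := by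
  obtain ⟨hpos, hw'⟩ := posProbVec_init hn hw
  have hA' (j : Fin (n + 1)) :
      (Fin.snoc (α := fun _ => Matrix (Fin m) (Fin m) ℂ) A X j : Matrix _ _ _).PosDef := by
    refine Fin.lastCases ?_ (fun j => ?_) j
    · rwa [Fin.snoc_last]
    · rw [Fin.snoc_castSucc]; exact hA j
  rw [eq_paramWassersteinMean_iff ht0 ht1 hw hA' hX, eq_paramWassersteinMean_iff ht0 ht1 hw' hA hX,
    gradSum, Fin.sum_univ_castSucc, gradSum]
  simp only [Fin.snoc_last, Fin.snoc_castSucc, mul_smul]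
  rw [← Finset.smul_sum, gradTerm_self ht0 hX, ← eq_sub_iff_add_eq]
  have e : (1 : Matrix (Fin m) (Fin m) ℂ) - w (Fin.last n) • 1 = (1 - w (Fin.last n)) • 1 := by
    rw [sub_smul, one_smul]
  rw [e, one_div, inv_smul_eq_iff₀ hpos.ne']

end Properties

theorem theoremT (m : ℕ) (t : ℝ) (ht0 : 0 < t) (ht1 : t < 1) :
    (∀ (n : ℕ) (w : Fin n → ℝ) (A : Fin n → Matrix (Fin m) (Fin m) ℂ),
      w ∈ posProbVec n → (∀ j, (A j).PosDef) →
      -- well-definedness: the mean is the unique minimizer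
      (IsParamWassersteinMean t w A (paramWassersteinMean t w A) ∧
        ∀ X, IsParamWassersteinMean t w A X → X = paramWassersteinMean t w A) ∧
      -- consistency with scalars
      ((∀ i j, Commute (A i) (A j)) →
        paramWassersteinMean t w A = (∑ j, w j • A j ^ (1 - t)) ^ (1 / (1 - t))) ∧
      -- homogeneity
      (∀ α : ℝ, 0 < α →
        paramWassersteinMean t w (fun j => α • A j) = α • paramWassersteinMean t w A) ∧
      -- permutation invariance
      (∀ σ : Equiv.Perm (Fin n),
        paramWassersteinMean t (fun j => w (σ j)) (fun j => A (σ j)) =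
          paramWassersteinMean t w A) ∧
      -- repetition invariance
      (∀ p : ℕ, 1 ≤ p →
        paramWassersteinMean t (fun k => 1 / (p : ℝ) * Fin.repeat p w k) (Fin.repeat p A) =
          paramWassersteinMean t w A) ∧
      -- unitary congruence invariance
      (∀ U ∈ Matrix.unitaryGroup (Fin m) ℂ,
        paramWassersteinMean t w (fun j => U * A j * Uᴴ) =
          U * paramWassersteinMean t w A * Uᴴ) ∧
      -- determinantal inequality (the determinants are real and positive)
      ∏ j, (A j).det.re ^ w j ≤ (paramWassersteinMean t w A).det.re) ∧
    -- omitting an argument that equals the mean; here there are `n + 1` weights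
    (∀ (n : ℕ) (w : Fin (n + 1) → ℝ) (A : Fin n → Matrix (Fin m) (Fin m) ℂ)
      (X : Matrix (Fin m) (Fin m) ℂ),
      1 ≤ n → w ∈ posProbVec (n + 1) → (∀ j, (A j).PosDef) → X.PosDef →
      (fun j : Fin n => 1 / (1 - w (Fin.last n)) * w j.castSucc) ∈ posProbVec n ∧
      (X = paramWassersteinMean t w (Fin.snoc (α := fun _ => Matrix (Fin m) (Fin m) ℂ) A X) ↔
        X = paramWassersteinMean t
          (fun j : Fin n => 1 / (1 - w (Fin.last n)) * w j.castSucc) A)) := by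

  refine ⟨fun n w A hw hA => ?_, fun n w A X hn hw hA hX =>
    ⟨(posProbVec_init hn hw).2, eq_paramWassersteinMean_snoc_iff ht0 ht1 hn hw hA hX⟩⟩
  obtain ⟨h1, h2, -⟩ := paramWassersteinMean_spec ht0 ht1 hw hA
  exact ⟨⟨h1, h2⟩, paramWassersteinMean_of_commute ht0 ht1 hw hA,
    fun α hα => paramWassersteinMean_smul ht0 ht1 hw hA hα,
    paramWassersteinMean_perm ht0 ht1 hw hA,
    fun p hp => paramWassersteinMean_repeat ht0 ht1 hw hA hp,
    fun U hU => paramWassersteinMean_unitary_conj ht0 ht1 hw hA hU,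
    prod_det_rpow_le_det_paramWassersteinMean ht0 ht1 hw hA⟩
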